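/- **Corollary 4.2.** Let $G$ be a group, and let $a_1G_1,\ldots,a_kG_k$ be a finite system of left cosets of subgroups $G_1,\ldots,G_k$ of $G$ which is a nontrivial uniform cover of $G$; that is, the number $|\{1\le i\le k: x\in a_iG_i\}|$ is the same for all $x\in G$, and not all the $G_i$ are equal to $G$. For a subgroup $H$ of $G$ let $H_G$ denote its core, the largest normal subgroup of $G$ contained in $H$. Then all the indices $[G:G_i]$ are finite. Let $N=\operatorname{lcm}([G:G_1],\ldots,[G:G_k])$, let $r$ be the number of distinct prime divisors of $N$, and let $\bar G=G/\bigl(\bigcap_{i=1}^kG_i\bigr)_G$. Let $p$ be any prime divisor of $|\bar G|$ with $p>r$; the largest prime divisor of $N$ exists and is an example of such a prime. Suppose that at least one of the following holds: 1. every $G_i$ with $[G:G_i]\ge p$ is subnormal in $G$, and $p$ divides $N$; 2. $\bar G$ is a solvable group having a normal Sylow $p$-subgroup. Then there is a pair $i,j$ with $1\le i<j\le k$ such that $[G:G_i]=[G:G_j]\equiv 0\pmod p$. -/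

import Mathlib

open scoped Pointwise

/-- The number of indices `i` such that `x` lies in the left coset `a i • H i`
(repeated cosets are counted as often as they occur). -/
noncomputable def coveringMultiplicity {G : Type*} [Group G] {k : ℕ}
    (a : Fin k → G) (H : Fin k → Subgroup G) (x : G) : ℕ :=
  {i : Fin k | x ∈ a i • (H i : Set G)}.ncard

/-- The finite system of left cosets `a i • H i` is a uniform cover of `G`:
its covering multiplicity does not depend on the element. -/
def IsUniformCover {G : Type*} [Group G] {k : ℕ}
    (a : Fin k → G) (H : Fin k → Subgroup G) : Prop :=
  ∀ x y : G, coveringMultiplicity a H x = coveringMultiplicity a H y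

/-- A uniform cover is nontrivial if not all of its subgroups are the whole group. -/
def IsNontrivialUniformCover {G : Type*} [Group G] {k : ℕ}
    (a : Fin k → G) (H : Fin k → Subgroup G) : Prop :=
  IsUniformCover a H ∧ ¬ ∀ i, H i = ⊤

/-- The least common multiple of the indices of the subgroups. -/
noncomputable def lcmIndex {G : Type*} [Group G] {k : ℕ} (H : Fin k → Subgroup G) : ℕ :=
  Finset.univ.lcm fun i => (H i).index

/-- The quotient of `G` by the core (largest normal subgroup inside) of `⋂ i, H i`. -/
abbrev CoreQuotient {G : Type*} [Group G] {k : ℕ} (H : Fin k → Subgroup G) : Type _ :=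
  G ⧸ (⨅ i, H i).normalCore

/-!
Let `p` be a prime as in the statement and suppose that the indices `nᵢ` divisible by `p` are
pairwise distinct. After dividing by the core of `⋂ i, H i` the group is finite: a coset of a
subgroup of infinite index would, by uniformity, lead to a cover of `G` by finitely many cosets of
subgroups of infinite index, against B. H. Neumann's lemma.

There is a normal subgroup `L` of index prime to `p` that lies in every `H i` of index prime to `p`
(the normal Sylow subgroup, or the normal closure of a Sylow subgroup). As the multiplicity
is constant, the members of index divisible by `p` then cover a union `U` of cosets of `L`,
and `U` is as dense in `G` as the union of their images in `G ⧸ L`. Two estimates contradict each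
other.

* `card_multiplesBelow_le_card_iUnion_coset`: in a finite group, the union of left cosets of
  subgroups that are all subnormal, or arbitrary if the group is solvable, is at least as dense as
  the union of the subgroups of `ℤ` of the same indices. The proof is an induction along a normal
  subgroup `M` for which each of the subgroups either lies in `M` or supplements `M`.
* `sum_inv_mul_lt_card_multiplesBelow`: if `mᵢ` is the part of `nᵢ` prime to `p`, then `∑ 1 / nᵢ` is
  less than the density of `⋃ i, mᵢ • ℤ`. Indeed every nonzero integer is uniquely a product of a
  number with all its primes in the set `S` of primes other than `p` and a number prime to `S`, so
  this density is at least `∏ q ∈ S, (1 - 1 / q) ≥ 1 / (|S| + 1)` times the sum of `1 / s` over the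
  distinct values `s` of the `mᵢ`; and summing over the powers of `p` that go with one `s` gives a
  factor less than `1 / (p - 1) ≤ 1 / (|S| + 1)`.

The indices in `G ⧸ L` divide the `mᵢ`, so the density of `U` exceeds `∑ 1 / nᵢ`; but it is at most
this sum, as `U` is the union of cosets of density `1 / nᵢ`.
-/

/-! ### Densities of sets of multiples -/

open Classical in
/-- The natural numbers below `n` that are divisible by at least one of the `d i`. For `n` a common
multiple of the `d i`, the number of its elements is `n` times the density of `⋃ i, d i • ℤ`. -/
noncomputable def multiplesBelow {ι : Type*} (d : ι → ℕ) (n : ℕ) : Finset ℕ :=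
  (Finset.range n).filter fun x => ∃ i, d i ∣ x

theorem mem_multiplesBelow {ι : Type*} {d : ι → ℕ} {n x : ℕ} :
    x ∈ multiplesBelow d n ↔ x < n ∧ ∃ i, d i ∣ x := by
  simp [multiplesBelow]

theorem card_filter_range_mul_of_periodic {P : ℕ → Prop} [DecidablePred P] {n : ℕ}
    (hP : Function.Periodic P n) (k : ℕ) :
    ((Finset.range (k * n)).filter P).card = k * ((Finset.range n).filter P).card := by
  induction k with
  | zero => simp
  | succ k ih =>
    rw [← Nat.count_eq_card_filter_range, ← Nat.count_eq_card_filter_range] at *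
    rw [Nat.succ_mul, Nat.count_add, ih, Nat.succ_mul]
    congr 2
    funext j
    have := hP.nat_mul k j
    rw [add_comm] at this
    simpa using this

theorem card_multiplesBelow_mul {ι : Type*} {d : ι → ℕ} {n : ℕ} (hd : ∀ i, d i ∣ n) (k : ℕ) :
    (multiplesBelow d (k * n)).card = k * (multiplesBelow d n).card := by
  classical
  refine card_filter_range_mul_of_periodic (fun x => ?_) k
  simp only [eq_iff_iff]
  exact exists_congr fun i => (Nat.dvd_add_left (hd i))

/-- This is `∏ q ∈ S, (1 - 1 / q) ≥ 1 / (|S| + 1)`: the worst case is `2, 3, …, |S| + 1`, where the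
product telescopes. -/
theorem prod_le_card_add_one_mul_totient (S : Finset ℕ) (hS : ∀ q ∈ S, q.Prime) :
    ∏ q ∈ S, q ≤ (S.card + 1) * (∏ q ∈ S, q).totient := by
  induction S using Finset.induction_on_max with
  | empty => simp
  | insert q S hmax ih =>
    have hq : q ∉ S := fun h => (hmax q h).false
    have hqp : q.Prime := hS q (by simp)
    have ih := ih fun x hx => hS x (by simp [hx])
    have hcop : q.Coprime (∏ x ∈ S, x) := Nat.Coprime.prod_right fun x hx =>
      (Nat.coprime_primes hqp (hS x (by simp [hx]))).2 fun h => hq (h ▸ hx)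
    have hcard : S.card + 2 ≤ q := by
      have hsub : S ⊆ Finset.Ico 2 q := fun x hx =>
        Finset.mem_Ico.2 ⟨(hS x (by simp [hx])).two_le, hmax x hx⟩
      have := Finset.card_le_card hsub
      have := hqp.two_le
      simp at *
      omega
    rw [Finset.prod_insert hq, Finset.card_insert_of_notMem hq, Nat.totient_mul hcop,
      Nat.totient_prime hqp]
    obtain ⟨t, rfl⟩ : ∃ t, q = t + 1 := ⟨q - 1, by omega⟩
    calc (t + 1) * ∏ x ∈ S, x ≤ (t + 1) * ((S.card + 1) * (∏ x ∈ S, x).totient) := by gcongr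
      _ = ((t + 1) * (S.card + 1)) * (∏ x ∈ S, x).totient := by ring
      _ ≤ ((S.card + 1 + 1) * t) * (∏ x ∈ S, x).totient := by
        refine Nat.mul_le_mul_right _ ?_
        nlinarith
      _ = _ := by simp; ring

theorem coprime_of_primeFactors_subset {S : Finset ℕ} {s u : ℕ} (hs : s.primeFactors ⊆ S)
    (hs0 : s ≠ 0) (hu : (∏ q ∈ S, q).Coprime u) : s.Coprime u := by
  refine Nat.coprime_of_dvd fun q hq hqs hqu => ?_
  have : q ∣ ∏ q ∈ S, q :=
    Finset.dvd_prod_of_mem _ (hs (Nat.mem_primeFactors.2 ⟨hq, hqs, hs0⟩))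
  exact hq.not_dvd_one (hu ▸ Nat.dvd_gcd this hqu)

/-- The multiples `s * u` of the elements `s` of `D` by numbers `u` coprime to the primes in `S` are
pairwise distinct, since all primes dividing `s` are in `S`. Counting them up to `W * ∏ q ∈ S, q`
bounds the number of all multiples of elements of `D` from below. -/
theorem sum_div_mul_totient_le (S : Finset ℕ)
    (D : Finset ℕ) (W : ℕ) (hW : W ≠ 0) (hDS : ∀ s ∈ D, s.primeFactors ⊆ S)
    (hDW : ∀ s ∈ D, s ∣ W) :
    ∑ s ∈ D, W / s * (∏ q ∈ S, q).totient ≤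
      (multiplesBelow (fun s : D => (s : ℕ)) (W * ∏ q ∈ S, q)).card := by
  classical
  set R := ∏ q ∈ S, q with hR
  have hD0 : ∀ s ∈ D, s ≠ 0 := fun s hs h => hW (Nat.eq_zero_of_zero_dvd (h ▸ hDW s hs))
  let E : ℕ → Finset ℕ := fun s =>
    ((Finset.range (W / s * R)).filter R.Coprime).image (s * ·)
  have hE : ∀ s ∈ D, (E s).card = W / s * R.totient := fun s hs => by
    rw [Finset.card_image_of_injective _ (mul_right_injective₀ (hD0 s hs)),
      card_filter_range_mul_of_periodic (Nat.periodic_coprime R)]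
    rfl
  have hdisj : (D : Set ℕ).PairwiseDisjoint E := by
    intro s hs t ht hst
    refine Finset.disjoint_left.2 fun x hxs hxt => hst ?_
    obtain ⟨u, hu, rfl⟩ := Finset.mem_image.1 hxs
    obtain ⟨v, hv, huv⟩ := Finset.mem_image.1 hxt
    rw [Finset.mem_filter] at hu hv
    replace huv : t * v = s * u := huv
    exact Nat.dvd_antisymm
      ((coprime_of_primeFactors_subset (hDS s hs) (hD0 s hs) hv.2).dvd_of_dvd_mul_right
        (huv ▸ dvd_mul_right s u))
      ((coprime_of_primeFactors_subset (hDS t ht) (hD0 t ht) hu.2).dvd_of_dvd_mul_right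
        (huv ▸ dvd_mul_right t v))
  rw [← Finset.sum_congr rfl hE, ← Finset.card_biUnion hdisj]
  refine Finset.card_le_card fun x hx => ?_
  obtain ⟨s, hs, hx⟩ := Finset.mem_biUnion.1 hx
  obtain ⟨u, hu, rfl⟩ := Finset.mem_image.1 hx
  rw [Finset.mem_filter, Finset.mem_range] at hu
  refine mem_multiplesBelow.2 ⟨?_, ⟨s, hs⟩, dvd_mul_right s u⟩
  calc s * u < s * (W / s * R) := Nat.mul_lt_mul_of_pos_left hu.1 (Nat.pos_of_ne_zero (hD0 s hs))
    _ = W * R := by rw [← mul_assoc, Nat.mul_div_cancel' (hDW s hs)]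

theorem sum_Icc_inv_pow_lt {p : ℕ} (hp : 2 ≤ p) (B : ℕ) :
    ∑ b ∈ Finset.Icc 1 B, ((p : ℚ) ^ b)⁻¹ < ((p : ℚ) - 1)⁻¹ := by
  have hp' : (2 : ℚ) ≤ p := by exact_mod_cast hp
  have key : ∑ b ∈ Finset.Icc 1 B, ((p : ℚ) ^ b)⁻¹ = ((p : ℚ) - 1)⁻¹ * (1 - ((p : ℚ) ^ B)⁻¹) := by
    induction B with
    | zero => simp
    | succ B ih =>
      rw [Finset.sum_Icc_succ_top (by omega), ih]
      have : (p : ℚ) - 1 ≠ 0 := by linarith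
      field_simp
      ring
  rw [key]
  refine mul_lt_of_lt_one_right (by rw [inv_pos]; linarith) ?_
  have : (0 : ℚ) < ((p : ℚ) ^ B)⁻¹ := by positivity
  linarith

/-- Distinct numbers with the same part prime to `p` are told apart by their power of `p`, so that each
`s` contributes at most `∑ b ≥ 1, 1 / (p ^ b * s)` to the left-hand side. -/
theorem sum_inv_lt_sum_inv_ordCompl {ι : Type*} (J : Finset ι) (hJ : J.Nonempty) (n : ι → ℕ)
    (hinj : Set.InjOn n J) {p : ℕ} (hp : p.Prime) (hn : ∀ i ∈ J, n i ≠ 0)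
    (hpn : ∀ i ∈ J, p ∣ n i) :
    ∑ i ∈ J, (n i : ℚ)⁻¹ <
      ((p : ℚ) - 1)⁻¹ * ∑ s ∈ J.image (fun i => ordCompl[p] (n i)), (s : ℚ)⁻¹ := by
  classical
  set D := J.image (fun i => ordCompl[p] (n i)) with hD
  let B := J.sup fun i => (n i).factorization p
  have hfac : ∀ i, p ^ (n i).factorization p * ordCompl[p] (n i) = n i := fun i =>
    Nat.ordProj_mul_ordCompl_eq_self _ _
  have hDpos : ∀ s ∈ D, (0 : ℚ) < s := by
    intro s hs
    obtain ⟨i, hi, rfl⟩ := Finset.mem_image.1 hs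
    exact_mod_cast Nat.ordCompl_pos p (hn i hi)
  have h1 : ∑ i ∈ J, (n i : ℚ)⁻¹ ≤
      ∑ x ∈ Finset.Icc 1 B ×ˢ D, ((p : ℚ) ^ x.1)⁻¹ * (x.2 : ℚ)⁻¹ := by
    let e : ι → ℕ × ℕ := fun i => ((n i).factorization p, ordCompl[p] (n i))
    have he : Set.InjOn e J := fun i hi j hj hij => hinj hi hj <| by
      rw [← hfac i, ← hfac j]
      obtain ⟨h1, h2⟩ := Prod.mk.inj hij
      rw [h2, h1]
    have h2 : ∑ i ∈ J, (n i : ℚ)⁻¹ = ∑ x ∈ J.image e, ((p : ℚ) ^ x.1)⁻¹ * (x.2 : ℚ)⁻¹ := by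
      rw [Finset.sum_image he]
      refine Finset.sum_congr rfl fun i _ => ?_
      rw [← mul_inv]
      congr 1
      exact_mod_cast (hfac i).symm
    rw [h2]
    refine Finset.sum_le_sum_of_subset_of_nonneg ?_ fun _ _ _ => by positivity
    intro x hx
    obtain ⟨i, hi, rfl⟩ := Finset.mem_image.1 hx
    exact Finset.mem_product.2 ⟨Finset.mem_Icc.2 ⟨hp.factorization_pos_of_dvd (hn i hi) (hpn i hi),
      Finset.le_sup (f := fun i => (n i).factorization p) hi⟩, Finset.mem_image_of_mem _ hi⟩
  refine h1.trans_lt ?_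
  rw [Finset.sum_product]
  dsimp only
  rw [← Finset.sum_mul_sum]
  exact mul_lt_mul_of_pos_right (sum_Icc_inv_pow_lt hp.two_le B)
    (Finset.sum_pos (fun s hs => inv_pos.2 (hDpos s hs)) (hJ.image _))

/-- Distinct numbers `n i` divisible by `p`, whose prime factors other than `p` lie in a set `S` of
fewer than `p - 1` primes, have a sum of reciprocals below the density of the union of the
`d i • ℤ`, if each `d i` divides the part of `n i` prime to `p`. -/
theorem sum_inv_mul_lt_card_multiplesBelow {ι : Type*} (J : Finset ι) (hJ : J.Nonempty)
    (n : ι → ℕ) (hinj : Set.InjOn n J) {p : ℕ} (hp : p.Prime) (hn : ∀ i ∈ J, n i ≠ 0)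
    (hpn : ∀ i ∈ J, p ∣ n i) (S : Finset ℕ) (hS : ∀ q ∈ S, q.Prime) (hSp : S.card + 1 < p)
    (hnS : ∀ i ∈ J, (n i).primeFactors ⊆ insert p S) (d : ι → ℕ)
    (hd : ∀ i ∈ J, d i ∣ ordCompl[p] (n i)) (T : ℕ) (hT : T ≠ 0) (hdT : ∀ i ∈ J, d i ∣ T) :
    (∑ i ∈ J, (n i : ℚ)⁻¹) * T < (multiplesBelow (fun i : J => d i) T).card := by
  classical
  set D := J.image (fun i => ordCompl[p] (n i)) with hD
  set R := ∏ q ∈ S, q with hR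
  have hR0 : R ≠ 0 := Finset.prod_ne_zero_iff.2 fun q hq => (hS q hq).ne_zero
  have hp1 : (0 : ℚ) < (p : ℚ) - 1 := by
    have : (2 : ℚ) ≤ p := by exact_mod_cast hp.two_le
    linarith
  have hD0 : ∀ s ∈ D, s ≠ 0 := by
    intro s hs
    obtain ⟨i, hi, rfl⟩ := Finset.mem_image.1 hs
    exact (Nat.ordCompl_pos p (hn i hi)).ne'
  have hDS : ∀ s ∈ D, s.primeFactors ⊆ S := by
    intro s hs q hq
    obtain ⟨i, hi, rfl⟩ := Finset.mem_image.1 hs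
    rw [Nat.mem_primeFactors] at hq
    rcases Finset.mem_insert.1 (hnS i hi (Nat.mem_primeFactors.2
      ⟨hq.1, hq.2.1.trans (Nat.ordCompl_dvd _ _), hn i hi⟩)) with rfl | h
    · exact absurd hq.2.1 (Nat.not_dvd_ordCompl hp (hn i hi))
    · exact h
  let W := ∏ s ∈ D, s
  have hW : W ≠ 0 := Finset.prod_ne_zero_iff.2 hD0
  have hDW : ∀ s ∈ D, s ∣ W := fun s hs => Finset.dvd_prod_of_mem _ hs
  have h1 := sum_inv_lt_sum_inv_ordCompl J hJ n hinj hp hn hpn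
  have h2 := sum_div_mul_totient_le S D W hW hDS hDW
  have h3 := prod_le_card_add_one_mul_totient S hS
  rw [← hD] at h1
  rw [← hR] at h2 h3
  -- both sets are counted up to the common multiple `T * (W * R)` of all moduli
  have h4 : T * (multiplesBelow (fun s : D => (s : ℕ)) (W * R)).card ≤
      (W * R) * (multiplesBelow (fun i : J => d i) T).card := by
    rw [← card_multiplesBelow_mul (fun s : D => (hDW s s.2).mul_right R),
      ← card_multiplesBelow_mul (fun i : J => hdT i i.2), mul_comm (W * R) T]
    refine Finset.card_le_card fun x hx => ?_
    rw [mem_multiplesBelow] at hx ⊢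
    obtain ⟨hx, ⟨s, hs⟩, hsx⟩ := hx
    obtain ⟨i, hi, rfl⟩ := Finset.mem_image.1 hs
    exact ⟨hx, ⟨i, hi⟩, (hd i hi).trans hsx⟩
  have h2' : (W : ℚ) * (∑ s ∈ D, (s : ℚ)⁻¹) * R.totient ≤
      (multiplesBelow (fun s : D => (s : ℕ)) (W * R)).card := by
    refine le_trans (le_of_eq ?_) (Nat.cast_le.2 h2)
    rw [Nat.cast_sum, Finset.mul_sum, Finset.sum_mul]
    refine Finset.sum_congr rfl fun s hs => ?_
    rw [Nat.cast_mul, Nat.cast_div (hDW s hs) (by exact_mod_cast hD0 s hs), div_eq_mul_inv]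
  have h3' : (R : ℚ) ≤ ((p : ℚ) - 1) * R.totient := by
    have h5 : R + R.totient ≤ p * R.totient := by nlinarith
    have : (R : ℚ) + R.totient ≤ p * R.totient := by exact_mod_cast h5
    linarith
  have hTpos : (0 : ℚ) < T := by exact_mod_cast Nat.pos_of_ne_zero hT
  have hWpos : (0 : ℚ) < W := by exact_mod_cast Nat.pos_of_ne_zero hW
  have hRpos : (0 : ℚ) < R := by exact_mod_cast Nat.pos_of_ne_zero hR0
  have h4' : (T : ℚ) * (multiplesBelow (fun s : D => (s : ℕ)) (W * R)).card ≤
      (W * R) * (multiplesBelow (fun i : J => d i) T).card := by exact_mod_cast h4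
  set sn := ∑ i ∈ J, (n i : ℚ)⁻¹
  set sD := ∑ s ∈ D, (s : ℚ)⁻¹
  have hsD : 0 ≤ sD := Finset.sum_nonneg fun s _ => by positivity
  rw [lt_inv_mul_iff₀ hp1] at h1
  refine lt_of_mul_lt_mul_left (a := (W : ℚ) * R) ?_ (by positivity)
  calc (W : ℚ) * R * (sn * T) ≤ (W * (((p : ℚ) - 1) * R.totient)) * (sn * T) := by
        gcongr
    _ = (((p : ℚ) - 1) * sn) * (W * R.totient * T) := by ring
    _ < sD * (W * R.totient * T) := by
        refine mul_lt_mul_of_pos_right h1 ?_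
        have : (0 : ℚ) < R.totient := by
          exact_mod_cast Nat.totient_pos.2 (Nat.pos_of_ne_zero hR0)
        positivity
    _ = T * (W * sD * R.totient) := by ring
    _ ≤ T * (multiplesBelow (fun s : D => (s : ℕ)) (W * R)).card := by gcongr
    _ ≤ _ := h4'

/-! ### Densities of unions of cosets in finite groups -/

/-- The density of `A ∪ ⋃ c, q • B c` is at most the average over the `q` indices `c` of the densities
of the sets `A ∪ B c`: a point of `q • B c` outside `A` comes from a point of `B c` outside `A`. -/
theorem card_filter_or_exists_mul_le {C : Type*} [Fintype C] {q n : ℕ}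
    (hq : Fintype.card C = q) (A : ℕ → Prop) (B : C → ℕ → Prop) [DecidablePred A]
    [∀ c, DecidablePred (B c)] [DecidablePred fun x => A x ∨ ∃ c y, x = q * y ∧ B c y]
    (hper : Function.Periodic A n) (hA : ∀ y, A y → A (q * y)) :
    ((Finset.range (q * n)).filter fun x => A x ∨ ∃ c y, x = q * y ∧ B c y).card ≤
      ∑ c, ((Finset.range n).filter fun y => A y ∨ B c y).card := by
  classical
  have hsub : ((Finset.range (q * n)).filter fun x => A x ∨ ∃ c y, x = q * y ∧ B c y) ⊆
      (Finset.range (q * n)).filter A ∪ Finset.univ.biUnion fun c =>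
        ((Finset.range n).filter fun y => B c y ∧ ¬ A y).image (q * ·) := by
    intro x hx
    rw [Finset.mem_filter, Finset.mem_range] at hx
    by_cases hAx : A x
    · exact Finset.mem_union_left _ (by simp [hx.1, hAx])
    · obtain ⟨c, y, rfl, hB⟩ := hx.2.resolve_left hAx
      refine Finset.mem_union_right _ (Finset.mem_biUnion.2 ⟨c, Finset.mem_univ c, ?_⟩)
      refine Finset.mem_image_of_mem _ (Finset.mem_filter.2 ⟨?_, hB, fun h => hAx (hA y h)⟩)
      exact Finset.mem_range.2 (Nat.lt_of_mul_lt_mul_left hx.1)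
  have hsplit : ∀ c, ((Finset.range n).filter fun y => A y ∨ B c y).card =
      ((Finset.range n).filter A).card +
        ((Finset.range n).filter fun y => B c y ∧ ¬ A y).card := by
    intro c
    rw [← Finset.card_union_of_disjoint]
    · congr 1
      ext y
      simp only [Finset.mem_union, Finset.mem_filter]
      tauto
    · exact Finset.disjoint_filter.2 fun y _ h h' => h'.2 h
  calc _ ≤ _ := Finset.card_le_card hsub
    _ ≤ _ := Finset.card_union_le _ _
    _ ≤ q * ((Finset.range n).filter A).card +
        ∑ c, ((Finset.range n).filter fun y => B c y ∧ ¬ A y).card := by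
      rw [card_filter_range_mul_of_periodic hper]
      gcongr
      exact Finset.card_biUnion_le.trans (Finset.sum_le_sum fun c _ => Finset.card_image_le)
    _ = _ := by
      simp_rw [hsplit]
      rw [Finset.sum_add_distrib, Finset.sum_const, Finset.card_univ, hq, smul_eq_mul]

theorem exists_maximal_normal_ge {G : Type*} [Group G] [Finite G] (N : Subgroup G) [N.Normal]
    (hN : N ≠ ⊤) : ∃ M : Subgroup G, N ≤ M ∧ M.Normal ∧ M ≠ ⊤ ∧
      ∀ K : Subgroup G, K.Normal → M ≤ K → K ≠ ⊤ → K = M := by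
  obtain ⟨M, hNM, hM⟩ := (Set.toFinite {M : Subgroup G | M.Normal ∧ M ≠ ⊤}).exists_le_maximal
    (show N ∈ _ from ⟨‹_›, hN⟩)
  exact ⟨M, hNM, hM.prop.1, hM.prop.2, fun K hK hMK hKt => (hM.eq_of_ge ⟨hK, hKt⟩ hMK)⟩

/-- A proper normal subgroup `M` such that every `K i` lies in `M` or satisfies `K i * M = G`. -/
theorem exists_normal_forall_le_or_sup_eq_top {G : Type*} [Group G] [Finite G] [Nontrivial G]
    {ι : Type*} (K : ι → Subgroup G)
    (h : (∀ i, (K i).IsSubnormal) ∨ Group.IsSolvable G) :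
    ∃ M : Subgroup G, M.Normal ∧ M ≠ ⊤ ∧ ∀ i, K i ≤ M ∨ K i ⊔ M = ⊤ := by
  rcases h with h | h
  · obtain ⟨M, -, hM, hMt, hmax⟩ := exists_maximal_normal_ge (⊥ : Subgroup G) bot_ne_top
    refine ⟨M, hM, hMt, fun i => ?_⟩
    have hsub : (K i ⊔ M).IsSubnormal := by
      have := (h i).quotient (K := M) |>.comap (QuotientGroup.mk' M)
      rwa [Subgroup.comap_map_eq, QuotientGroup.ker_mk'] at this
    rcases hsub.lt_normal with h1 | ⟨N, hN, hle, hlt⟩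
    · exact Or.inr h1
    · exact Or.inl (hmax N hN (le_sup_right.trans hle) hlt.ne ▸ le_sup_left.trans hle)
  · obtain ⟨M, hcM, hM, hMt, hmax⟩ := exists_maximal_normal_ge (commutator G)
      (Group.IsSolvable.commutator_lt_top_of_nontrivial G).ne
    refine ⟨M, hM, hMt, fun i => ?_⟩
    have hnorm : (K i ⊔ M).Normal :=
      Subgroup.Normal.of_commutator_le _ (hcM.trans le_sup_right)
    by_cases ht : K i ⊔ M = ⊤
    · exact Or.inr ht
    · exact Or.inl (hmax _ hnorm le_sup_right ht ▸ le_sup_left)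

/-- Replacing the left cosets `a i • K i` by the subgroups of `ℤ` of the same indices does not
increase the density of their union. -/
theorem card_multiplesBelow_le_card_iUnion_coset {G : Type*} [Group G] [Finite G]
    {ι : Type*} (a : ι → G) (K : ι → Subgroup G)
    (h : (∀ i, (K i).IsSubnormal) ∨ Group.IsSolvable G) :
    (multiplesBelow (fun i => (K i).index) (Nat.card G)).card ≤
      {x : G | ∃ i, (a i)⁻¹ * x ∈ K i}.ncard := by
  classical
  obtain ⟨N, hN⟩ : ∃ N, Nat.card G = N := ⟨_, rfl⟩
  induction N using Nat.strong_induction_on generalizing G ι with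
  | _ N IH =>
  rcases subsingleton_or_nontrivial G with hG | hG
  · rcases isEmpty_or_nonempty ι with hι | ⟨⟨i⟩⟩
    · simp [multiplesBelow]
    · refine (Finset.card_filter_le _ _).trans ?_
      rw [Finset.card_range, Nat.card_of_subsingleton (1 : G), Nat.one_le_iff_ne_zero]
      exact Set.ncard_ne_zero_of_mem (a := a i) ⟨i, by simp⟩
  obtain ⟨M, hM, hMt, hMK⟩ := exists_normal_forall_le_or_sup_eq_top K h
  have hcard : M.index * Nat.card M = Nat.card G := M.index_mul_card
  have hMlt : Nat.card M < N := by
    rw [← hN, ← hcard]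
    have h1 : M.index ≠ 1 := fun h => hMt (Subgroup.index_eq_one.1 h)
    have h2 : M.index ≠ 0 := Subgroup.FiniteIndex.index_ne_zero
    exact lt_mul_of_one_lt_left Nat.card_pos (by omega)
  have : Fintype (G ⧸ M) := Fintype.ofFinite _
  -- `I c` lists the cosets `a i • K i` that meet the coset `c` of `M`; translated back to `M`, the
  -- intersection of such a coset with `c` is a left coset of `K i ⊓ M`
  let I : G ⧸ M → Type _ := fun c => {i : ι // ∃ k ∈ K i, c.out⁻¹ * a i * k ∈ M}
  have htop : ∀ c : G ⧸ M, ∀ i, K i ⊔ M = ⊤ → ∃ k ∈ K i, c.out⁻¹ * a i * k ∈ M := by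
    intro c i hi
    have hmem : (c.out⁻¹ * a i)⁻¹ ∈ K i ⊔ M := hi ▸ Subgroup.mem_top _
    obtain ⟨k, hk, m, hm, hkm⟩ := Subgroup.mem_sup_of_normal_right.1 hmem
    refine ⟨k, hk, ?_⟩
    have : c.out⁻¹ * a i = m⁻¹ * k⁻¹ := by
      rw [← inv_inj, ← hkm]; group
    rw [this]
    simpa using hm
  have hrel_top : ∀ i, K i ⊔ M = ⊤ → (K i).relIndex M = (K i).index := by
    intro i hi
    have h2 : M.relIndex (K i) = M.index := by
      rw [← Subgroup.relIndex_sup_right, hi, Subgroup.relIndex_top_right]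
    have h3 := Subgroup.relIndex_inf_mul_relIndex (K i) M ⊤
    have h4 := Subgroup.relIndex_inf_mul_relIndex M (K i) ⊤
    simp only [Subgroup.relIndex_top_right, inf_top_eq] at h3 h4
    rw [h2, inf_comm, ← h3, mul_comm] at h4
    exact (Nat.eq_of_mul_eq_mul_right
      (Nat.pos_of_ne_zero Subgroup.FiniteIndex.index_ne_zero) h4).symm
  have hrel_le : ∀ i, K i ≤ M → (K i).relIndex M * M.index = (K i).index := fun i hi =>
    Subgroup.relIndex_mul_index hi
  have hIH : ∀ c : G ⧸ M,
      (multiplesBelow (fun i : I c => (K i.1).relIndex M) (Nat.card M)).card ≤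
        {x : G | (x : G ⧸ M) = c ∧ ∃ i, (a i)⁻¹ * x ∈ K i}.ncard := by
    intro c
    choose k hk hkM using fun i : I c => i.2
    have := IH (Nat.card M) hMlt (fun i : I c => (⟨_, hkM i⟩ : M))
      (fun i : I c => (K i.1).subgroupOf M)
      (h.imp (fun h i => (h i.1).subgroupOf) (fun (hs : Group.IsSolvable G) =>
        Group.isSolvable_of_isSolvable_injective M.subtype_injective)) rfl
    refine this.trans ?_
    refine Set.ncard_le_ncard_of_injOn (fun y : M => c.out * y) ?_ ?_ (Set.toFinite _)
    · rintro y ⟨i, hi⟩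
      refine ⟨?_, i.1, ?_⟩
      · conv_rhs => rw [← Quotient.out_eq' c]
        exact (QuotientGroup.mk_mul_of_mem _ y.2)
      · rw [Subgroup.mem_subgroupOf] at hi
        have := (K i.1).mul_mem (hk i) hi
        convert this using 1
        simp [mul_assoc]
    · intro x _ y _ hxy
      exact Subtype.ext (mul_left_cancel hxy)
  -- a subgroup supplementing `M` keeps its index and meets all cosets of `M`; for a subgroup of `M`
  -- the index drops by the factor `M.index`, and each of its cosets meets only one coset of `M`
  let A : ℕ → Prop := fun x => ∃ i, K i ⊔ M = ⊤ ∧ (K i).index ∣ x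
  let B : G ⧸ M → ℕ → Prop := fun c y => ∃ i : I c, (K i.1).relIndex M ∣ y
  have key := card_filter_or_exists_mul_le (C := G ⧸ M) (q := M.index) (n := Nat.card M)
    (by rw [Subgroup.index, Nat.card_eq_fintype_card]) A B
    (fun x => by
      simp only [A, eq_iff_iff]
      refine exists_congr fun i => and_congr_right fun hi => Nat.dvd_add_left ?_
      rw [← hrel_top i hi]
      exact Subgroup.relIndex_dvd_card _ _)
    (fun y ⟨i, hi, hd⟩ => ⟨i, hi, hd.mul_left _⟩)
  rw [hcard] at key
  calc _ ≤ _ := Finset.card_le_card (fun x hx => ?_)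
    _ ≤ _ := key
    _ ≤ ∑ c : G ⧸ M, {x : G | (x : G ⧸ M) = c ∧ ∃ i, (a i)⁻¹ * x ∈ K i}.ncard := by
      refine Finset.sum_le_sum fun c _ => le_trans (Finset.card_le_card fun y hy => ?_) (hIH c)
      rw [Finset.mem_filter, Finset.mem_range] at hy
      refine mem_multiplesBelow.2 ⟨hy.1, ?_⟩
      rcases hy.2 with ⟨i, hi, hd⟩ | hB
      · exact ⟨⟨i, htop c i hi⟩, by simpa only [hrel_top i hi] using hd⟩
      · exact hB
    _ = _ := by
      have : Fintype G := Fintype.ofFinite G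
      rw [Set.ncard_eq_toFinset_card', Finset.card_eq_sum_card_fiberwise
        (f := fun x : G => (x : G ⧸ M)) (t := Finset.univ) (fun _ _ => Finset.mem_univ _)]
      refine Finset.sum_congr rfl fun c _ => ?_
      rw [Set.ncard_eq_toFinset_card']
      congr 1
      ext x
      simp [and_comm]
  obtain ⟨hx, i, hi⟩ := mem_multiplesBelow.1 hx
  refine Finset.mem_filter.2 ⟨Finset.mem_range.2 hx, ?_⟩
  rcases hMK i with hle | ht
  · right
    have hi' : (K i).index ∣ x := hi
    rw [← hrel_le i hle] at hi'
    obtain ⟨z, rfl⟩ := hi'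
    refine ⟨(a i : G ⧸ M), (K i).relIndex M * z, by ring, ⟨i, 1, one_mem _, ?_⟩, dvd_mul_right _ _⟩
    rw [mul_one]
    exact QuotientGroup.eq.1 (Quotient.out_eq' _)
  · exact Or.inl ⟨i, ht, hi⟩

/-! ### Uniform covers -/

theorem mem_smul_subgroup_iff {G : Type*} [Group G] {a x : G} {H : Subgroup G} :
    x ∈ a • (H : Set G) ↔ a⁻¹ * x ∈ H := mem_leftCoset_iff a

/-- If all members of a uniform cover that are not selected by `P` are unions of left cosets of
`N`, then the multiplicity of the selected ones is constant on left cosets of `N`. -/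
theorem IsUniformCover.ncard_eq_of_le {G : Type*} [Group G] {k : ℕ} {a : Fin k → G}
    {H : Fin k → Subgroup G} (hc : IsUniformCover a H) (P : Fin k → Prop) (N : Subgroup G)
    (hN : ∀ i, ¬ P i → N ≤ H i) (x : G) {n : G} (hn : n ∈ N) :
    {i | P i ∧ x ∈ a i • (H i : Set G)}.ncard =
      {i | P i ∧ x * n ∈ a i • (H i : Set G)}.ncard := by
  have hsplit : ∀ y, coveringMultiplicity a H y =
      {i | P i ∧ y ∈ a i • (H i : Set G)}.ncard +
        {i | ¬ P i ∧ y ∈ a i • (H i : Set G)}.ncard := by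
    intro y
    rw [coveringMultiplicity, ← Set.ncard_union_eq]
    · congr 1
      ext i
      simp only [Set.mem_ofPred_eq, Set.mem_union]
      tauto
    · exact Set.disjoint_left.2 fun i h h' => h'.1 h.1
  have hnot : {i | ¬ P i ∧ x ∈ a i • (H i : Set G)} =
      {i | ¬ P i ∧ x * n ∈ a i • (H i : Set G)} := by
    ext i
    refine and_congr_right fun hi => ?_
    rw [mem_smul_subgroup_iff, mem_smul_subgroup_iff, ← mul_assoc,
      Subgroup.mul_mem_cancel_right _ (hN i hi hn)]
  have h := hc x (x * n)
  rw [hsplit, hsplit, hnot] at h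
  exact Nat.add_right_cancel h

/-- If some members had infinite index, then by uniformity those members would cover a whole coset of
the intersection `N` of the other ones, and their finitely many translates would cover `G`. -/
theorem IsUniformCover.finiteIndex {G : Type*} [Group G] {k : ℕ} {a : Fin k → G}
    {H : Fin k → Subgroup G} (hc : IsUniformCover a H) (i₀ : Fin k) : (H i₀).FiniteIndex := by
  classical
  by_contra hi₀
  let N : Subgroup G := ⨅ i, if (H i).FiniteIndex then H i else ⊤
  have hNfin : N.FiniteIndex := Subgroup.finiteIndex_iInf fun i => by
    split_ifs with h
    · exact h
    · infer_instance
  have hcov := fun n (hn : n ∈ N) => hc.ncard_eq_of_le (fun i => ¬ (H i).FiniteIndex) N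
    (fun i hi => (iInf_le _ i).trans (by rw [if_pos (not_not.1 hi)])) (a i₀) hn
  have hex : ∀ n ∈ N, ∃ i, ¬ (H i).FiniteIndex ∧ a i₀ * n ∈ a i • (H i : Set G) := by
    intro n hn
    refine Set.nonempty_of_ncard_ne_zero (s := {i | ¬ (H i).FiniteIndex ∧
      a i₀ * n ∈ a i • (H i : Set G)}) ?_
    rw [← hcov n hn]
    exact Set.ncard_ne_zero_of_mem (a := i₀) ⟨hi₀, by simp [mem_smul_subgroup_iff]⟩
  have : Fintype (G ⧸ N) := Fintype.ofFinite _
  obtain ⟨⟨t, i⟩, -, hi⟩ := Subgroup.exists_finiteIndex_of_leftCoset_cover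
    (s := (Finset.univ : Finset ((G ⧸ N) × {i // ¬ (H i).FiniteIndex})))
    (g := fun x => x.1.out * (a i₀)⁻¹ * a x.2) (H := fun x => H x.2) <| by
      refine Set.eq_univ_of_forall fun x => ?_
      obtain ⟨i, hi, hx⟩ := hex ((x : G ⧸ N).out⁻¹ * x)
        (QuotientGroup.eq.1 (Quotient.out_eq' _))
      refine Set.mem_iUnion₂.2 ⟨((x : G ⧸ N), ⟨i, hi⟩), Finset.mem_univ _, ?_⟩
      rw [mem_smul_subgroup_iff] at hx ⊢
      convert hx using 1
      group
  exact i.2 hi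

theorem card_preimage_quotient_mk {G : Type*} [Group G] (L : Subgroup G) (s : Set (G ⧸ L)) :
    ((fun x : G => (x : G ⧸ L)) ⁻¹' s).ncard = Nat.card L * s.ncard := by
  rw [← Nat.card_coe_set_eq, ← Nat.card_coe_set_eq, ← Nat.card_prod]
  exact Nat.card_congr (QuotientGroup.preimageMkEquivSubgroupProdSet L s)

/-- The members of index divisible by `p` cover a union of cosets of `L`, so their union is as dense as
the union of their images in `G ⧸ L`; distinct indices would make it less dense than that. -/
theorem IsUniformCover.exists_index_eq_of_normal {G : Type*} [Group G] [Finite G] {k : ℕ}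
    {a : Fin k → G} {H : Fin k → Subgroup G} (hc : IsUniformCover a H) {p : ℕ} (hp : p.Prime)
    (L : Subgroup G) [L.Normal] (hL : ¬ p ∣ L.index)
    (hLH : ∀ i, ¬ p ∣ (H i).index → L ≤ H i) (hex : ∃ i, p ∣ (H i).index)
    (hsub : (∀ i, p ∣ (H i).index → (H i).IsSubnormal) ∨ Group.IsSolvable (G ⧸ L))
    (S : Finset ℕ) (hS : ∀ q ∈ S, q.Prime) (hSp : S.card + 1 < p)
    (hHS : ∀ i, (H i).index.primeFactors ⊆ insert p S) :
    ∃ i j, i < j ∧ (H i).index = (H j).index ∧ p ∣ (H i).index := by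
  classical
  by_contra! hne
  let J : Finset (Fin k) := Finset.univ.filter fun i => p ∣ (H i).index
  have hJ : ∀ i ∈ J, p ∣ (H i).index := fun i hi => (Finset.mem_filter.1 hi).2
  have hinj : Set.InjOn (fun i => (H i).index) J := by
    intro i hi j hj hij
    rcases lt_trichotomy i j with h | h | h
    · exact absurd (hJ i hi) (hne i j h hij)
    · exact h
    · exact absurd (hJ j hj) (hne j i h hij.symm)
  have hJne : J.Nonempty := by
    obtain ⟨i, hi⟩ := hex
    exact ⟨i, by simp [J, hi]⟩
  let K : Fin k → Subgroup (G ⧸ L) := fun i => (H i).map (QuotientGroup.mk' L)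
  have hKL : ∀ i, (K i).index ∣ Nat.card (G ⧸ L) := fun i => (K i).index_dvd_card
  have hK : ∀ i, (K i).index ∣ ordCompl[p] (H i).index := by
    intro i
    have hcop : p.Coprime (K i).index :=
      (hp.coprime_iff_not_dvd).2 fun h => hL (h.trans (hKL i))
    refine (hcop.symm.pow_right ((H i).index.factorization p)).dvd_of_dvd_mul_left ?_
    rw [Nat.ordProj_mul_ordCompl_eq_self]
    exact (H i).index_map_dvd (QuotientGroup.mk'_surjective L)
  have harith := sum_inv_mul_lt_card_multiplesBelow J hJne (fun i => (H i).index) hinj hp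
    (fun i _ => Subgroup.FiniteIndex.index_ne_zero) hJ S hS hSp (fun i _ => hHS i)
    (fun i => (K i).index) (fun i _ => hK i) (Nat.card (G ⧸ L)) Nat.card_pos.ne' (fun i _ => hKL i)
  have hdens := card_multiplesBelow_le_card_iUnion_coset (fun i : J => (a i : G ⧸ L))
    (fun i : J => K i) (hsub.imp (fun h i => (h i (hJ i i.2)).quotient) id)
  set V : Set (G ⧸ L) := {y | ∃ i : J, (a i : G ⧸ L)⁻¹ * y ∈ K i} with hV
  have hVU : ((fun x : G => (x : G ⧸ L)) ⁻¹' V) ⊆ ⋃ i ∈ J, a i • (H i : Set G) := by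
    rintro x ⟨i, h, hh, hx⟩
    have hl : x⁻¹ * (a i * h) ∈ L := by
      rw [← QuotientGroup.eq, QuotientGroup.mk_mul]
      rw [QuotientGroup.mk'_apply] at hx
      rw [hx, mul_inv_cancel_left]
    have hcard := hc.ncard_eq_of_le (fun i => p ∣ (H i).index) L hLH x hl
    rw [mul_inv_cancel_left] at hcard
    obtain ⟨j, hj, hxj⟩ := Set.nonempty_of_ncard_ne_zero
      (s := {i | p ∣ (H i).index ∧ x ∈ a i • (H i : Set G)}) <| by
        rw [hcard]
        exact Set.ncard_ne_zero_of_mem (a := (i : Fin k))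
          ⟨hJ i i.2, by simpa [mem_smul_subgroup_iff] using hh⟩
    exact Set.mem_iUnion₂.2 ⟨j, by simp [J, hj], hxj⟩
  have hcardU : Nat.card L * V.ncard ≤ ∑ i ∈ J, Nat.card (H i) := by
    rw [← card_preimage_quotient_mk]
    refine (Set.ncard_le_ncard hVU (Set.toFinite _)).trans
      ((Finset.set_ncard_biUnion_le J _).trans (Finset.sum_le_sum fun i _ => ?_))
    rw [Set.ncard_smul_set, ← Nat.card_coe_set_eq]
    rfl
  have hsum : ((∑ i ∈ J, Nat.card (H i) : ℕ) : ℚ) =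
      (∑ i ∈ J, ((H i).index : ℚ)⁻¹) * Nat.card (G ⧸ L) * Nat.card L := by
    rw [mul_assoc, Nat.cast_sum, Finset.sum_mul]
    refine Finset.sum_congr rfl fun i _ => ?_
    have h1 : (Nat.card (G ⧸ L) : ℚ) * Nat.card L = Nat.card (H i) * (H i).index := by
      exact_mod_cast (L.card_eq_card_quotient_mul_card_subgroup).symm.trans
        (H i).card_mul_index.symm
    have h2 : ((H i).index : ℚ) ≠ 0 := by
      exact_mod_cast (Subgroup.FiniteIndex.index_ne_zero : (H i).index ≠ 0)
    rw [h1]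
    field_simp
  have hLpos : (0 : ℚ) < Nat.card L := by exact_mod_cast Nat.card_pos
  have h1 : ((multiplesBelow (fun i : J => (K i).index) (Nat.card (G ⧸ L))).card : ℚ) ≤ V.ncard := by
    exact_mod_cast hdens
  have h2 : (Nat.card L : ℚ) * V.ncard ≤ (∑ i ∈ J, Nat.card (H i) : ℕ) := by
    exact_mod_cast hcardU
  rw [hsum] at h2
  have h3 := mul_lt_mul_of_pos_left (harith.trans_le h1) hLpos
  linarith

/-! ### Subgroups of index prime to `p` -/

theorem Subgroup.IsSubnormal.relIndex_dvd_index {G : Type*} [Group G] {H : Subgroup G}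
    (hH : H.IsSubnormal) (K : Subgroup G) : H.relIndex K ∣ H.index := by
  induction hH with
  | top => simp
  | step H M hle _ hnorm ih =>
    have h := Subgroup.relIndex_inf_mul_relIndex H M K
    rw [inf_of_le_left hle] at h
    rw [← h, ← Subgroup.relIndex_mul_index hle, ← Subgroup.relIndex_subgroupOf inf_le_left]
    exact mul_dvd_mul (Subgroup.relIndex_dvd_index_of_normal _ _) ih

theorem IsPGroup.le_of_not_dvd_relIndex {G : Type*} [Group G] [Finite G] {p : ℕ} (hp : p.Prime)
    {P H : Subgroup G} (hP : IsPGroup p P) (h : ¬ p ∣ H.relIndex P) : P ≤ H := by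
  have := Fact.mk hp
  obtain ⟨n, hn⟩ := IsPGroup.iff_card.1 hP
  obtain ⟨m, -, hm⟩ := (Nat.dvd_prime_pow hp).1 (hn ▸ H.relIndex_dvd_card P)
  rw [← Subgroup.relIndex_eq_one, hm]
  cases m with
  | zero => simp
  | succ m => exact absurd (hm ▸ dvd_pow_self p m.succ_ne_zero) h

/-- The normal subgroup generated by the Sylow `p`-subgroups lies in every subgroup of index prime
to `p` that is subnormal or of index less than `p`. -/
theorem exists_normal_le_of_not_dvd_index {G : Type*} [Group G] [Finite G] {p : ℕ}
    (hp : p.Prime) : ∃ L : Subgroup G, L.Normal ∧ ¬ p ∣ L.index ∧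
      ∀ H : Subgroup G, (p ≤ H.index → H.IsSubnormal) → ¬ p ∣ H.index → L ≤ H := by
  have := Fact.mk hp
  let P : Sylow p G := default
  refine ⟨Subgroup.normalClosure (P : Set G), inferInstance,
    fun h => P.not_dvd_index (h.trans (Subgroup.index_dvd_of_le Subgroup.le_normalClosure)), ?_⟩
  intro H hH hpH
  refine (Subgroup.closure_le H).2 fun x hx => ?_
  obtain ⟨y, hy, hyx⟩ := Group.mem_conjugatesOfSet_iff.1 hx
  obtain ⟨g, rfl⟩ := isConj_iff.1 hyx
  refine (g • P).2.le_of_not_dvd_relIndex hp (H := H) (fun hdvd => ?_) ⟨y, hy, rfl⟩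
  rcases lt_or_ge H.index p with hlt | hge
  · have h1 := Nat.le_of_dvd (Nat.pos_of_ne_zero
      (mt Subgroup.index_eq_zero_of_relIndex_eq_zero Subgroup.FiniteIndex.index_ne_zero)) hdvd
    have h2 := Subgroup.relIndex_le_of_le_right (H := H) (K := (g • P : Sylow p G)) le_top
      (by rw [Subgroup.relIndex_top_right]; exact Subgroup.FiniteIndex.index_ne_zero)
    rw [Subgroup.relIndex_top_right] at h2
    omega
  · exact hpH (hdvd.trans ((hH hge).relIndex_dvd_index _))

theorem Sylow.le_of_not_dvd_index_of_normal {G : Type*} [Group G] [Finite G] {p : ℕ}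
    (hp : p.Prime) (P : Sylow p G) (hPn : (P : Subgroup G).Normal) {H : Subgroup G}
    (hH : ¬ p ∣ H.index) : (P : Subgroup G) ≤ H := by
  have := Fact.mk hp
  refine P.2.le_of_not_dvd_relIndex hp fun hdvd => hH ?_
  have h3 := Subgroup.relIndex_inf_mul_relIndex H P ⊤
  have h4 := Subgroup.relIndex_inf_mul_relIndex P H ⊤
  simp only [Subgroup.relIndex_top_right, inf_top_eq] at h3 h4
  rw [inf_comm, ← h3] at h4
  -- `[P : H ⊓ P] * [G : P] = [H : H ⊓ P] * [G : H]`, and `[H : H ⊓ P]` divides `[G : P]`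
  have h5 : p ∣ (P : Subgroup G).relIndex H * H.index := h4 ▸ hdvd.mul_right _
  exact (hp.dvd_mul.1 h5).resolve_left fun h =>
    P.not_dvd_index (h.trans (Subgroup.relIndex_dvd_index_of_normal _ _))

/-! ### The least common multiple of the indices -/

theorem index_dvd_lcmIndex {G : Type*} [Group G] {k : ℕ} (H : Fin k → Subgroup G) (i : Fin k) :
    (H i).index ∣ lcmIndex H :=
  Finset.dvd_lcm (Finset.mem_univ i)

theorem exists_dvd_index_of_dvd_lcmIndex {G : Type*} [Group G] {k : ℕ} {H : Fin k → Subgroup G}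
    {p : ℕ} (hp : p.Prime) (h : p ∣ lcmIndex H) : ∃ i, p ∣ (H i).index := by
  have h1 : p ∣ ∏ i, (H i).index :=
    h.trans (Finset.lcm_dvd fun i hi => Finset.dvd_prod_of_mem _ hi)
  obtain ⟨i, -, hi⟩ := (hp.prime.dvd_finsetProd_iff _).1 h1
  exact ⟨i, hi⟩

theorem lcmIndex_ne_zero {G : Type*} [Group G] {k : ℕ} {H : Fin k → Subgroup G}
    (hH : ∀ i, (H i).FiniteIndex) : lcmIndex H ≠ 0 := fun h => by
  obtain ⟨i, -, hi⟩ := Finset.lcm_eq_zero_iff.1 h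
  exact (hH i).index_ne_zero hi

theorem exists_isGreatest_prime_dvd {n : ℕ} (hn0 : n ≠ 0) (hn1 : n ≠ 1) :
    ∃ q, IsGreatest {q : ℕ | q.Prime ∧ q ∣ n} q ∧ n.primeFactors.card < q := by
  have hne : n.primeFactors.Nonempty := Nat.nonempty_primeFactors.2 (by omega)
  have hmem := Nat.mem_primeFactors.1 (Finset.max'_mem _ hne)
  refine ⟨n.primeFactors.max' hne, ⟨⟨hmem.1, hmem.2.1⟩, fun q hq =>
    Finset.le_max' _ _ (Nat.mem_primeFactors.2 ⟨hq.1, hq.2, hn0⟩)⟩, ?_⟩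
  have hsub : n.primeFactors ⊆ Finset.Icc 2 (n.primeFactors.max' hne) := fun q hq =>
    Finset.mem_Icc.2 ⟨(Nat.prime_of_mem_primeFactors hq).two_le, Finset.le_max' _ _ hq⟩
  have := Finset.card_le_card hsub
  have := hmem.1.two_le
  rw [Nat.card_Icc] at *
  omega

/-! ### Passage to the quotient by the core -/

theorem IsUniformCover.map_quotient {G : Type*} [Group G] {k : ℕ} {a : Fin k → G}
    {H : Fin k → Subgroup G} (hc : IsUniformCover a H) (C : Subgroup G) [C.Normal]
    (hC : ∀ i, C ≤ H i) :
    IsUniformCover (fun i => (a i : G ⧸ C)) fun i => (H i).map (QuotientGroup.mk' C) := by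
  have key : ∀ x : G, coveringMultiplicity (fun i => (a i : G ⧸ C))
      (fun i => (H i).map (QuotientGroup.mk' C)) (x : G ⧸ C) = coveringMultiplicity a H x := by
    intro x
    unfold coveringMultiplicity
    congr 1
    ext i
    have h : ((H i).map (QuotientGroup.mk' C)).comap (QuotientGroup.mk' C) = H i :=
      Subgroup.comap_map_eq_self (by rw [QuotientGroup.ker_mk']; exact hC i)
    simp only [Set.mem_ofPred_eq, mem_smul_subgroup_iff]
    conv_rhs => rw [← h, Subgroup.mem_comap]
    rfl
  intro x y
  induction x using QuotientGroup.induction_on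
  induction y using QuotientGroup.induction_on
  rw [key, key]
  exact hc _ _

theorem corollary4p2 {G : Type*} [Group G] {k : ℕ} (a : Fin k → G) (H : Fin k → Subgroup G)
    (hcover : IsNontrivialUniformCover a H) :
    (∀ i, (H i).FiniteIndex) ∧
    (∃ q : ℕ, IsGreatest {q : ℕ | q.Prime ∧ q ∣ lcmIndex H} q ∧
      (lcmIndex H).primeFactors.card < q ∧ q ∣ Nat.card (CoreQuotient H)) ∧
    ∀ p : ℕ, p.Prime → p ∣ Nat.card (CoreQuotient H) →
      (lcmIndex H).primeFactors.card < p →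
      (((∀ i, p ≤ (H i).index → (H i).IsSubnormal) ∧ p ∣ lcmIndex H) ∨
        (Group.IsSolvable (CoreQuotient H) ∧
          ∃ P : Sylow p (CoreQuotient H), (P : Subgroup (CoreQuotient H)).Normal)) →
      ∃ i j : Fin k, i < j ∧ (H i).index = (H j).index ∧ p ∣ (H i).index := by
  classical
  obtain ⟨hc, hnt⟩ := hcover
  have hfin : ∀ i, (H i).FiniteIndex := hc.finiteIndex
  have hN0 : lcmIndex H ≠ 0 := lcmIndex_ne_zero hfin
  let C := (⨅ i, H i).normalCore
  have hC : ∀ i, C ≤ H i := fun i => (Subgroup.normalCore_le _).trans (iInf_le _ i)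
  have hinf : (⨅ i, H i).FiniteIndex := Subgroup.finiteIndex_iInf hfin
  have hCfin : C.FiniteIndex := inferInstance
  have hfinQ : Finite (CoreQuotient H) := inferInstanceAs (Finite (G ⧸ C))
  refine ⟨hfin, ?_, ?_⟩
  · obtain ⟨i, hi⟩ := not_forall.1 hnt
    have hN1 : lcmIndex H ≠ 1 := fun h =>
      hi (Subgroup.index_eq_one.1 (Nat.dvd_one.1 (h ▸ index_dvd_lcmIndex H i)))
    obtain ⟨q, hq, hlt⟩ := exists_isGreatest_prime_dvd hN0 hN1
    obtain ⟨j, hj⟩ := exists_dvd_index_of_dvd_lcmIndex hq.1.1 hq.1.2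
    exact ⟨q, hq, hlt, hj.trans (Subgroup.index_dvd_of_le (hC j))⟩
  intro p hp hpQ hrp hcases
  let π : G →* CoreQuotient H := QuotientGroup.mk' C
  have hπ : Function.Surjective π := QuotientGroup.mk'_surjective C
  have hker : ∀ i, π.ker ≤ H i := fun i => (QuotientGroup.ker_mk' C).trans_le (hC i)
  let K : Fin k → Subgroup (CoreQuotient H) := fun i => (H i).map π
  have hKi : ∀ i, (K i).index = (H i).index := fun i => (H i).index_map_eq hπ (hker i)
  have hcK : IsUniformCover (fun i => (a i : CoreQuotient H)) K := hc.map_quotient C hC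
  have hfact := Fact.mk hp
  -- a normal subgroup of index prime to `p` inside all members of index prime to `p`
  obtain ⟨L, hL, hLp, hLK, hsub, i₀, hi₀⟩ : ∃ L : Subgroup (CoreQuotient H), ∃ _ : L.Normal,
      ¬ p ∣ L.index ∧ (∀ i, ¬ p ∣ (K i).index → L ≤ K i) ∧
      ((∀ i, p ∣ (K i).index → (K i).IsSubnormal) ∨ Group.IsSolvable (CoreQuotient H ⧸ L)) ∧
      ∃ i, p ∣ (K i).index := by
    rcases hcases with ⟨hsub, hpN⟩ | ⟨hsol, P, hP⟩
    · obtain ⟨L, hL, hLp, hLH⟩ := exists_normal_le_of_not_dvd_index (G := CoreQuotient H) hp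
      have hKsub : ∀ i, p ≤ (K i).index → (K i).IsSubnormal := fun i hi =>
        (hsub i (hKi i ▸ hi)).map hπ
      obtain ⟨i, hi⟩ := exists_dvd_index_of_dvd_lcmIndex hp hpN
      refine ⟨L, hL, hLp, fun i => hLH (K i) (hKsub i), Or.inl fun i hi => hKsub i ?_, i, ?_⟩
      · exact Nat.le_of_dvd (Nat.pos_of_ne_zero (hKi i ▸ (hfin i).index_ne_zero)) hi
      · rwa [hKi]
    · have hle : ∀ i, ¬ p ∣ (K i).index → (P : Subgroup (CoreQuotient H)) ≤ K i :=
        fun i hi => P.le_of_not_dvd_index_of_normal hp hP hi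
      refine ⟨P, hP, P.not_dvd_index, hle, Or.inr inferInstance, ?_⟩
      -- otherwise the Sylow subgroup lies in every `K i`, whose intersection has trivial core
      by_contra! hno
      have h1 : (P : Subgroup (CoreQuotient H)).comap π ≤ ⨅ i, H i := le_iInf fun i => by
        rw [← Subgroup.comap_map_eq_self (hker i)]
        exact Subgroup.comap_mono (hle i (hno i))
      have h2 : (P : Subgroup (CoreQuotient H)).comap π ≤ C :=
        Subgroup.normal_le_normalCore.2 h1
      have h3 : (P : Subgroup (CoreQuotient H)) = ⊥ := by
        rw [← Subgroup.map_comap_eq_self_of_surjective hπ (P : Subgroup (CoreQuotient H)),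
          Subgroup.map_eq_bot_iff]
        exact h2.trans_eq (QuotientGroup.ker_mk' C).symm
      have h4 := P.dvd_card_of_dvd_card hpQ
      rw [h3, Subgroup.card_bot] at h4
      exact hp.not_dvd_one h4
  have hpmem : p ∈ (lcmIndex H).primeFactors :=
    Nat.mem_primeFactors.2 ⟨hp, (hKi i₀ ▸ hi₀).trans (index_dvd_lcmIndex H i₀), hN0⟩
  obtain ⟨i, j, hij, heq, hdvd⟩ := hcK.exists_index_eq_of_normal hp L hLp hLK ⟨i₀, hi₀⟩ hsub
    ((lcmIndex H).primeFactors.erase p)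
    (fun q hq => Nat.prime_of_mem_primeFactors (Finset.mem_of_mem_erase hq))
    (by rwa [Finset.card_erase_add_one hpmem])
    (fun i => by
      rw [Finset.insert_erase hpmem, hKi]
      exact Nat.primeFactors_mono (index_dvd_lcmIndex H i) hN0)
  exact ⟨i, j, hij, by rwa [hKi, hKi] at heq, by rwa [hKi] at hdvd⟩
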